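/- **Theorem (quantitative equality problem).** A probabilistic automaton consists of a finite set $Q$ of states, an initial state $q_\iota\in Q$, a finite alphabet $\Sigma$ and, for each $\sigma\in\Sigma$, a stochastic matrix $M_\sigma$ on $Q$. For an infinite word $w=w_1w_2\cdots\in\Sigma^\omega$ let $\mathbb{P}^w$ be the probability measure on infinite state sequences for which the probability of the prefix $q_0,q_1,\dots,q_n$ is $\prod_{i=1}^{n} M_{w_i}(q_{i-1},q_i)$ if $q_0=q_\iota$, and $0$ otherwise. For a set $F\subseteq Q$ of accepting states, the acceptance probability of $w$ is $\mathbb{P}^w(\forall i\ge 0:\ q_i\in F)$ for the safety condition and $\mathbb{P}^w(\exists i\ge 0:\ q_i\in F)$ for the reachability condition. The automaton is acceptance-absorbing if $M_\sigma(q,q)=1$ for all $q\in F$ and $\sigma\in\Sigma$. The quantitative equality problem is undecidable, both (a) for safety automata and (b) for acceptance-absorbing reachability automata: in each case there is no algorithm that, given such an automaton with rational transition probabilities, the set $F$, and a rational number $0<\lambda<1$, decides whether there is a word $w\in\Sigma^\omega$ whose acceptance probability is exactly $\lambda$. The problem remains undecidable for the fixed threshold $\lambda=\tfrac13$ in case (a),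 and for the fixed threshold $\lambda=\tfrac23$ in case (b). -/

import Mathlib

open MeasureTheory ProbabilityTheory

/-- A probabilistic automaton with (finite) state set `Q` and (finite) alphabet `S`:
an initial state and, for every letter, a stochastic matrix on `Q`. -/
structure ProbAutomaton (Q S : Type) [Fintype Q] where
  init : Q
  M : S → Q → Q → ℝ
  nonneg : ∀ s q q', 0 ≤ M s q q'
  sum_eq_one : ∀ s q, ∑ q', M s q q' = 1

namespace ProbAutomaton

section Measure

variable {Q S : Type} [Fintype Q] (A : ProbAutomaton Q S)

/-- The distribution of the next state when letter `s` is read in state `q`. -/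
noncomputable def next (s : S) (q : Q) : PMF Q :=
  PMF.ofFintype (fun q' => ENNReal.ofReal (A.M s q q')) (by
    rw [← ENNReal.ofReal_sum_of_nonneg (fun q' _ => A.nonneg s q q'), A.sum_eq_one,
      ENNReal.ofReal_one])

variable [MeasurableSpace Q] [MeasurableSingletonClass Q]

/-- The transition kernel at time `n` for the infinite word `w`: given the states at times
`0, …, n`, the state at time `n + 1` is drawn from the row of `M (w n)` of the current state. -/
noncomputable def kernel (w : ℕ → S) (n : ℕ) : Kernel (Finset.Iic n → Q) Q :=
  Kernel.ofFunOfCountable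
    (fun x => (A.next (w n) (x ⟨n, Finset.mem_Iic.2 le_rfl⟩)).toMeasure)

instance isMarkovKernel_kernel (w : ℕ → S) (n : ℕ) : IsMarkovKernel (A.kernel w n) :=
  ⟨fun x => PMF.toMeasure.isProbabilityMeasure
    (A.next (w n) (x ⟨n, Finset.mem_Iic.2 le_rfl⟩))⟩

/-- The probability measure on the infinite state sequences that is induced by the infinite
word `w`. It starts in the initial state almost surely and its values on cones are given by
`pathMeasure_cone`, which determine it. -/
noncomputable def pathMeasure (w : ℕ → S) : Measure (ℕ → Q) :=
  Kernel.trajMeasure (X := fun _ => Q) (Measure.dirac A.init) (A.kernel w)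

instance isProbabilityMeasure_pathMeasure (w : ℕ → S) : IsProbabilityMeasure (A.pathMeasure w) := by
  unfold pathMeasure; infer_instance

/-- The value of the path measure on the cone of the finite sequence `q 0, …, q n`. -/
theorem pathMeasure_cone [DecidableEq Q] (w : ℕ → S) (q : ℕ → Q) (n : ℕ) :
    A.pathMeasure w {p | ∀ i ≤ n, p i = q i} =
      (if q 0 = A.init then 1 else 0) *
        ∏ i ∈ Finset.range n, ENNReal.ofReal (A.M (w i) (q i) (q (i + 1))) := by
  classical
  induction n with
  | zero =>
    have hs : {p : ℕ → Q | ∀ i ≤ 0, p i = q i} =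
        (fun x : ℕ → Q => x 0) ⁻¹' {q 0} := by
      ext p; simp
    have h0 : ∀ x : Finset.Iic 0 → Q,
        (Kernel.traj (X := fun _ => Q) (A.kernel w) 0 x) ((fun x : ℕ → Q => x 0) ⁻¹' {q 0}) =
          if q 0 = x ⟨0, Finset.mem_Iic.2 le_rfl⟩ then 1 else 0 := by
      intro x
      have h1 := Kernel.traj_map_frestrictLe_apply (X := fun _ => Q) (κ := A.kernel w) 0 0 x
      have h2 : (fun x : ℕ → Q => x 0) ⁻¹' {q 0} =
          (Preorder.frestrictLe (π := fun _ => Q) 0) ⁻¹'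
            {y : Finset.Iic 0 → Q | y ⟨0, Finset.mem_Iic.2 le_rfl⟩ = q 0} := rfl
      rw [h2, ← Measure.map_apply (Preorder.measurable_frestrictLe 0) (Set.to_countable _).measurableSet,
        h1, Kernel.partialTraj_self, Kernel.id_apply,
        Measure.dirac_apply' _ (Set.to_countable _).measurableSet]
      simp [Set.indicator_apply, eq_comm]
    rw [hs, pathMeasure, Kernel.trajMeasure, Measure.bind_apply]
    · simp_rw [h0]
      rw [lintegral_map (measurable_of_countable _) (by fun_prop), lintegral_dirac]
      simp
    · exact measurable_pi_apply 0 (measurableSet_singleton _)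
    · exact (Kernel.measurable _).aemeasurable
  | succ n ih =>
    have h := Kernel.map_frestrictLe_trajMeasure_compProd_eq_map_trajMeasure
      (X := fun _ => Q) (μ₀ := Measure.dirac A.init) (κ := A.kernel w) (a := n)
    have hs : {p : ℕ → Q | ∀ i ≤ n + 1, p i = q i} =
        (fun x : ℕ → Q => (Preorder.frestrictLe (π := fun _ => Q) n x, x (n + 1))) ⁻¹'
          ({fun i : Finset.Iic n => q i} ×ˢ {q (n + 1)}) := by
      ext p
      simp only [Set.mem_ofPred_eq, Set.mem_preimage, Set.mem_prod, Set.mem_singleton_iff,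
        funext_iff, Subtype.forall, Finset.mem_Iic, Preorder.frestrictLe_apply]
      exact ⟨fun H => ⟨fun i hi => H i (by omega), H _ le_rfl⟩, fun H i hi => by
        rcases Nat.lt_or_ge n i with hn | hn
        · obtain rfl : i = n + 1 := by omega
          exact H.2
        · exact H.1 i hn⟩
    have hs' : {p : ℕ → Q | ∀ i ≤ n, p i = q i} =
        (Preorder.frestrictLe (π := fun _ => Q) n) ⁻¹' {fun i : Finset.Iic n => q i} := by
      ext p
      simp only [Set.mem_ofPred_eq, Set.mem_preimage, Set.mem_singleton_iff,
        funext_iff, Subtype.forall, Finset.mem_Iic, Preorder.frestrictLe_apply]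
    rw [hs', pathMeasure, ← Measure.map_apply (Preorder.measurable_frestrictLe n)
      (measurableSet_singleton _)] at ih
    rw [hs, pathMeasure, ← Measure.map_apply (by fun_prop)
      ((measurableSet_singleton _).prod (measurableSet_singleton _)), ← h,
      Measure.compProd_apply_prod (measurableSet_singleton _) (measurableSet_singleton _),
      Measure.restrict_singleton, lintegral_smul_measure, lintegral_dirac, ih,
      Finset.prod_range_succ, ← mul_assoc, smul_eq_mul]
    congr 1
    change (A.next (w n) (q n)).toMeasure {q (n + 1)} = _
    rw [PMF.toMeasure_apply_singleton _ _ (measurableSet_singleton _)]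
    rfl

/-- The acceptance probability of the infinite word `w` for the set `Φ` of accepted paths. -/
noncomputable def acceptProb (Φ : Set (ℕ → Q)) (w : ℕ → S) : ℝ :=
  (A.pathMeasure w).real Φ

end Measure

/-- A state is absorbing if it is kept with probability one under every letter. -/
def IsAbsorbing {Q S : Type} [Fintype Q] (A : ProbAutomaton Q S) (q : Q) : Prop :=
  ∀ s, A.M s q q = 1

/-- An automaton with accepting states `F` is acceptance-absorbing if every state of `F` is
absorbing. -/
def AcceptanceAbsorbing {Q S : Type} [Fintype Q] (A : ProbAutomaton Q S) (F : Finset Q) : Prop :=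
  ∀ q ∈ F, A.IsAbsorbing q

end ProbAutomaton

/-- The safety condition: only states of `F` are visited. -/
def Safe {Q : Type} (F : Finset Q) : Set (ℕ → Q) := {p | ∀ i, p i ∈ F}

/-- The reachability condition: some state of `F` is visited. -/
def Reach {Q : Type} (F : Finset Q) : Set (ℕ → Q) := {p | ∃ i, p i ∈ F}

/-- The pair `c` of natural numbers is a fraction (not necessarily reduced) with value `x`. -/
def IsFraction (c : ℕ × ℕ) (x : ℝ) : Prop := c.2 ≠ 0 ∧ x = (c.1 : ℝ) / (c.2 : ℝ)

/-- Finite descriptions of automata with accepting states: the number of states, the number of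
letters, the index of the initial state, the membership list of the accepting states, and the
list of the transition matrices, each given by its list of rows of fractions. -/
abbrev AutomatonCode : Type := ℕ × ℕ × ℕ × List Bool × List (List (List (ℕ × ℕ)))

/-- `c` describes the automaton `A` (which then has rational transition probabilities) with
accepting states `F`. -/
def Encodes {n m : ℕ} (c : AutomatonCode) (A : ProbAutomaton (Fin n) (Fin m))
    (F : Finset (Fin n)) : Prop :=
  ∃ fr : Fin m → Fin n → Fin n → ℕ × ℕ,
    (∀ s q q', IsFraction (fr s q q') (A.M s q q')) ∧
      c = (n, m, (A.init : ℕ), List.ofFn (fun q => decide (q ∈ F)),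
        List.ofFn fun s => List.ofFn fun q => List.ofFn fun q' => fr s q q')

/-- The quantitative equality problem is decidable for the class `C` of automata with accepting
states, the acceptance condition `Φ` and thresholds in `Λ`: there is a partial recursive function
which, on every description of an automaton of the class and every fraction for a threshold
`r ∈ Λ`, halts with the correct answer to the question whether some infinite word has acceptance
probability exactly `r`. Nothing is required on other inputs. -/
def QuantEqualityDecidable
    (C : ∀ n m : ℕ, ProbAutomaton (Fin n) (Fin m) → Finset (Fin n) → Prop)
    (Φ : ∀ n : ℕ, Finset (Fin n) → Set (ℕ → Fin n)) (Λ : Set ℚ) : Prop :=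
  ∃ f : AutomatonCode × (ℕ × ℕ) →. Bool, Partrec f ∧
    ∀ (n m : ℕ) (A : ProbAutomaton (Fin n) (Fin m)) (F : Finset (Fin n)) (r : ℚ)
      (c : AutomatonCode) (l : ℕ × ℕ),
      C n m A F → r ∈ Λ → Encodes c A F → IsFraction l (r : ℝ) →
        ∃ b ∈ f (c, l), (b = true ↔ ∃ w : ℕ → Fin m, A.acceptProb (Φ n F) w = (r : ℝ))

/-!
The halting problem is reduced to the question whether some infinite word reaches an absorbing
state with probability exactly `2 / 3`. Complementing the accepting set turns this into a safety
automaton and the threshold `1 / 3`, and a decision procedure for all thresholds in `(0, 1)` would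
decide the two fixed ones.

The reduction goes through *guarded systems*: a vector `x` of natural numbers is transformed by
matrices `upd s`, one for each letter `s`, and a letter may be read only if its guards, which are
equations between linear forms in `x`, hold. The system accepts `x` if some finite word with
satisfied guards ends in a final letter.

*From guarded systems to probabilistic automata.* The matrix `x ⊗ x` also evolves linearly, so a
multiple of it can be stored as the masses of `d × d` many states, the cells. When `s` is read, a
part of these masses is sent to the sinks `acc` and `rej`, in the ratio `2 : 1` up to a correction
that moves from `acc` to `rej` a multiple of the sum of the squared guard violations, which is a
quadratic form in `x`; unused mass goes to the state `wait`. A final letter sends everything to the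
sinks. Count mass in `acc` as one and undecided mass as `2 / 3`. This value starts at `2 / 3`,
never increases, and decreases exactly when a guard is violated (`GuardedSystem.value_step`). As
`wait` keeps a fixed amount of mass until a final letter is read, the probability of `acc` is
`2 / 3` if and only if a final letter is read and no guard is violated before
(`GuardedSystem.accepts_iff_tendsto`).

*From machines to guarded systems.* Mathlib compiles partial recursive functions to programs with
finitely many control states and four stacks. A stack is a number in base `B`, whose digits are the
symbols. The word announces the top symbol `r` of the stack `n` and prepares a guess `y` for the
rest by increments from zero; the guard `n = r + B * y` then verifies both, and every stack
operation becomes linear in `y` (`StackMachine.accepts_iff_dom`). For a fixed universal program only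
the initial vector depends on the input, and it enters the automaton only through the row of the
initial state, so the reduction is computable.
-/

/-! ### Reachability of absorbing states as a limit of state distributions -/

namespace ProbAutomaton

variable {Q S : Type} [Fintype Q] (A : ProbAutomaton Q S)

section Mass

variable [DecidableEq Q]

/-- The distribution of the state at time `t` under the infinite word `w`, as a vector that is
propagated by the transition matrices. -/
noncomputable def mass (w : ℕ → S) : ℕ → Q → ℝ
  | 0, q => if q = A.init then 1 else 0
  | t + 1, q' => ∑ q, mass w t q * A.M (w t) q q'

theorem mass_nonneg (w : ℕ → S) (t : ℕ) (q : Q) : 0 ≤ A.mass w t q := by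
  induction t generalizing q with
  | zero => simp only [mass]; split_ifs <;> simp
  | succ t ih => exact Finset.sum_nonneg fun q' _ => mul_nonneg (ih q') (A.nonneg _ _ _)

end Mass

variable [MeasurableSpace Q] [MeasurableSingletonClass Q]

theorem measurableSet_coord (t : ℕ) (s : Set Q) : MeasurableSet {p : ℕ → Q | p t ∈ s} :=
  measurable_pi_apply t (Set.to_countable s).measurableSet

/-- The joint distribution of two consecutive states. -/
theorem pathMeasure_pair (w : ℕ → S) (t : ℕ) (q q' : Q) :
    A.pathMeasure w {p | p t = q ∧ p (t + 1) = q'} =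
      A.pathMeasure w {p | p t = q} * ENNReal.ofReal (A.M (w t) q q') := by
  have h := Kernel.map_frestrictLe_trajMeasure_compProd_eq_map_trajMeasure
    (X := fun _ => Q) (μ₀ := Measure.dirac A.init) (κ := A.kernel w) (a := t)
  set s : Set (Finset.Iic t → Q) := {x | x ⟨t, Finset.mem_Iic.2 le_rfl⟩ = q} with hs
  have hsm : MeasurableSet s := (Set.to_countable _).measurableSet
  have h1 : {p : ℕ → Q | p t = q ∧ p (t + 1) = q'} =
      (fun x : ℕ → Q => (Preorder.frestrictLe (π := fun _ => Q) t x, x (t + 1))) ⁻¹'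
        (s ×ˢ {q'}) := rfl
  have h2 : {p : ℕ → Q | p t = q} = (Preorder.frestrictLe (π := fun _ => Q) t) ⁻¹' s := rfl
  rw [h1, h2, pathMeasure, ← Measure.map_apply (by fun_prop)
      (hsm.prod (measurableSet_singleton _)), ← h,
    Measure.compProd_apply_prod hsm (measurableSet_singleton _),
    ← Measure.map_apply (Preorder.measurable_frestrictLe t) hsm]
  have h3 : ∀ x ∈ s, A.kernel w t x {q'} = ENNReal.ofReal (A.M (w t) q q') := by
    intro x hx
    change (A.next (w t) (x ⟨t, Finset.mem_Iic.2 le_rfl⟩)).toMeasure {q'} = _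
    rw [PMF.toMeasure_apply_singleton _ _ (measurableSet_singleton _), show x _ = q from hx]
    rfl
  rw [setLIntegral_congr_fun hsm h3, setLIntegral_const, mul_comm]

/-- An absorbing state is never left, up to a null set. -/
theorem pathMeasure_leave {a : Q} (ha : A.IsAbsorbing a) (w : ℕ → S) (t : ℕ) :
    A.pathMeasure w {p | p t = a ∧ p (t + 1) ≠ a} = 0 := by
  classical
  have hU : {p : ℕ → Q | p t = a ∧ p (t + 1) ≠ a} =
      ⋃ q' : {q' : Q // q' ≠ a}, {p | p t = a ∧ p (t + 1) = q'.1} := by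
    ext p; simp
  rw [hU, measure_iUnion_null_iff]
  rintro ⟨q', hq'⟩
  have h0 : A.M (w t) a q' = 0 := by
    have h1 := A.sum_eq_one (w t) a
    rw [← Finset.add_sum_erase _ _ (Finset.mem_univ a), ha (w t)] at h1
    have h2 : ∑ q ∈ Finset.univ.erase a, A.M (w t) a q = 0 := by linarith
    exact (Finset.sum_eq_zero_iff_of_nonneg fun q _ => A.nonneg _ _ _).1 h2 q' (by simpa using hq')
  simp only [pathMeasure_pair, h0, ENNReal.ofReal_zero, mul_zero]

variable [DecidableEq Q]

theorem pathMeasure_coord (w : ℕ → S) (t : ℕ) (q : Q) :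
    A.pathMeasure w {p | p t = q} = ENNReal.ofReal (A.mass w t q) := by
  induction t generalizing q with
  | zero =>
    have h := A.pathMeasure_cone w (fun _ => q) 0
    simp only [Nat.le_zero, forall_eq, Finset.range_zero, Finset.prod_empty, mul_one] at h
    rw [h, mass]
    split_ifs <;> simp
  | succ t ih =>
    have hU : {p : ℕ → Q | p (t + 1) = q} = ⋃ q' : Q, {p | p t = q' ∧ p (t + 1) = q} := by
      ext p; simp
    rw [hU, measure_iUnion, tsum_fintype]
    · simp_rw [pathMeasure_pair, ih, ← ENNReal.ofReal_mul (A.mass_nonneg _ _ _)]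
      rw [← ENNReal.ofReal_sum_of_nonneg fun q' _ => mul_nonneg (A.mass_nonneg _ _ _)
        (A.nonneg _ _ _)]
      rfl
    · intro a b hab
      refine Set.disjoint_left.2 fun p hp hp' => hab (hp.1.symm.trans hp'.1)
    · exact fun q' => (measurableSet_coord t {q'}).inter (measurableSet_coord (t + 1) {q})

/-- Having visited an absorbing state until time `t` means being there at time `t`. -/
theorem pathMeasure_visit {a : Q} (ha : A.IsAbsorbing a) (w : ℕ → S) (t : ℕ) :
    A.pathMeasure w {p | ∃ i ≤ t, p i = a} = ENNReal.ofReal (A.mass w t a) := by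
  rw [← pathMeasure_coord]
  refine le_antisymm ?_ (measure_mono fun p hp => ⟨t, le_rfl, hp⟩)
  have hsub : {p : ℕ → Q | ∃ i ≤ t, p i = a} ⊆
      {p | p t = a} ∪ ⋃ i, {p | p i = a ∧ p (i + 1) ≠ a} := by
    rintro p ⟨i, hi, hpi⟩
    by_contra hcon
    simp only [Set.mem_union, Set.mem_iUnion, Set.mem_ofPred_eq, not_or, not_exists, not_and,
      not_not] at hcon
    exact hcon.1 (Nat.le_induction hpi (fun j _ hj => hcon.2 j hj) t hi)
  refine (measure_mono hsub).trans ((measure_union_le _ _).trans ?_)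
  rw [measure_iUnion_null fun i => A.pathMeasure_leave ha w i, add_zero]

/-- The probability of reaching an absorbing state is the limit of its masses. -/
theorem tendsto_mass {a : Q} (ha : A.IsAbsorbing a) (w : ℕ → S) :
    Filter.Tendsto (fun t => A.mass w t a) Filter.atTop
      (nhds (A.acceptProb (Reach {a}) w)) := by
  have hU : Reach {a} = ⋃ t, {p : ℕ → Q | ∃ i ≤ t, p i = a} := by
    ext p
    simp only [Reach, Finset.mem_singleton, Set.mem_ofPred_eq, Set.mem_iUnion]
    exact ⟨fun ⟨i, hi⟩ => ⟨i, i, le_rfl, hi⟩, fun ⟨_, i, _, hi⟩ => ⟨i, hi⟩⟩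
  have hmono : Monotone fun t => {p : ℕ → Q | ∃ i ≤ t, p i = a} :=
    fun s t hst p ⟨i, hi, hp⟩ => ⟨i, hi.trans hst, hp⟩
  have h := tendsto_measure_iUnion_atTop (μ := A.pathMeasure w) hmono
  rw [← hU] at h
  have h' := (ENNReal.tendsto_toReal (measure_ne_top _ _)).comp h
  refine h'.congr fun t => ?_
  rw [Function.comp_apply, Function.comp_apply, pathMeasure_visit A ha,
    ENNReal.toReal_ofReal (A.mass_nonneg _ _ _)]

/-- Safety with respect to `F` is the complementary event of reaching the complement of `F`. -/
theorem acceptProb_safe_compl (w : ℕ → S) (F : Finset Q) :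
    A.acceptProb (Safe Fᶜ) w = 1 - A.acceptProb (Reach F) w := by
  have hm : MeasurableSet (Reach F) := by
    have : Reach F = ⋃ i, {p : ℕ → Q | p i ∈ (F : Set Q)} := by ext p; simp [Reach]
    rw [this]
    exact MeasurableSet.iUnion fun i => measurableSet_coord i _
  have : Safe Fᶜ = (Reach F)ᶜ := by ext p; simp [Safe, Reach]
  rw [acceptProb, acceptProb, this, probReal_compl_eq_one_sub hm]

end ProbAutomaton

/-! ### Guarded systems and their probabilistic automata -/

/-- A guarded system with dimension `d`, letters `S` and `G`-many guards for each letter. Reading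
`s` transforms the vector `x` into `upd s *ᵥ x`; the guard `g` of `s` is the equation
`lhs s g ⬝ᵥ x = rhs s g ⬝ᵥ x`. The transformation of a final letter is irrelevant. -/
structure GuardedSystem (d S G : Type) where
  upd : S → Matrix d d ℕ
  lhs : S → G → d → ℕ
  rhs : S → G → d → ℕ
  final : S → Bool

namespace GuardedSystem

open Matrix

variable {d S G : Type} [Fintype d] (L : GuardedSystem d S G)

/-- The letter `s` may be read in `x`: all its guards hold. -/
def Ok (s : S) (x : d → ℕ) : Prop := ∀ g, L.lhs s g ⬝ᵥ x = L.rhs s g ⬝ᵥ x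

/-- From the given vector, some finite word can be read such that all guards hold and the last
letter, and no other, is final. -/
inductive Accepts : (d → ℕ) → Prop
  | final {s : S} {x : d → ℕ} : L.Ok s x → L.final s = true → Accepts x
  | step {s : S} {x : d → ℕ} : L.Ok s x → L.final s = false → Accepts (L.upd s *ᵥ x) → Accepts x

/-- The vectors that are visited when the word `u` is read from `x`, whether or not the guards
hold. -/
def run (u : ℕ → S) (x : d → ℕ) : ℕ → d → ℕ
  | 0 => x
  | t + 1 => L.upd (u t) *ᵥ run u x t

theorem run_succ' (u : ℕ → S) (x : d → ℕ) (t : ℕ) :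
    L.run u x (t + 1) = L.run (fun i => u (i + 1)) (L.upd (u 0) *ᵥ x) t := by
  induction t with
  | zero => rfl
  | succ t ih => rw [run, ih, run]

theorem accepts_iff (x : d → ℕ) :
    L.Accepts x ↔ ∃ (u : ℕ → S) (T : ℕ), L.final (u T) = true ∧ (∀ t < T, L.final (u t) = false) ∧
      ∀ t ≤ T, L.Ok (u t) (L.run u x t) := by
  constructor
  · intro h
    induction h with
    | @final s x hok hf =>
      exact ⟨fun _ => s, 0, hf, by simp, fun t ht => by rw [Nat.le_zero.1 ht]; exact hok⟩
    | @step s x hok hf _ ih =>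
      obtain ⟨u, T, h1, h2, h3⟩ := ih
      refine ⟨fun t => t.casesOn s u, T + 1, h1, fun t ht => ?_, fun t ht => ?_⟩
      · cases t with
        | zero => exact hf
        | succ t => exact h2 t (by omega)
      · cases t with
        | zero => exact hok
        | succ t => rw [run_succ']; exact h3 t (by omega)
  · rintro ⟨u, T, h1, h2, h3⟩
    induction T generalizing u x with
    | zero => exact .final (h3 0 le_rfl) h1
    | succ T ih =>
      refine .step (h3 0 (Nat.zero_le _)) (h2 0 (Nat.succ_pos _))
        (ih _ (fun i => u (i + 1)) h1 (fun t ht => h2 _ (by omega)) fun t ht => ?_)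
      rw [← run_succ']
      exact h3 _ (by omega)

variable [Fintype G]

/-- The sum of the squared violations of the guards of `s`. -/
def err (s : S) (x : d → ℕ) : ℝ :=
  ∑ g, (((L.lhs s g ⬝ᵥ x : ℕ) : ℝ) - ((L.rhs s g ⬝ᵥ x : ℕ) : ℝ)) ^ 2

theorem err_nonneg (s : S) (x : d → ℕ) : 0 ≤ L.err s x := Finset.sum_nonneg fun _ _ => sq_nonneg _

theorem err_eq_zero (s : S) (x : d → ℕ) : L.err s x = 0 ↔ L.Ok s x := by
  rw [err, Finset.sum_eq_zero_iff_of_nonneg fun _ _ => sq_nonneg _]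
  simp [Ok, sub_eq_zero]

/-- The coefficients of `err` as a quadratic form. -/
def form (s : S) (p : d × d) : ℤ :=
  ∑ g, ((L.lhs s g p.1 : ℤ) - L.rhs s g p.1) * ((L.lhs s g p.2 : ℤ) - L.rhs s g p.2)

theorem sum_form (s : S) (x : d → ℕ) :
    ∑ p : d × d, (x p.1 * x p.2 : ℝ) * L.form s p = L.err s x := by
  have h : ∀ g, ((L.lhs s g ⬝ᵥ x : ℕ) : ℝ) - ((L.rhs s g ⬝ᵥ x : ℕ) : ℝ) =
      ∑ i, ((L.lhs s g i : ℝ) - L.rhs s g i) * x i := by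
    intro g
    simp only [dotProduct, Nat.cast_sum, Nat.cast_mul, sub_mul, Finset.sum_sub_distrib]
  simp only [err, h, form, Int.cast_sum, Finset.mul_sum]
  rw [Finset.sum_comm]
  refine Finset.sum_congr rfl fun g _ => ?_
  rw [sq, Finset.sum_mul_sum, Fintype.sum_prod_type]
  refine Finset.sum_congr rfl fun i _ => Finset.sum_congr rfl fun j _ => ?_
  push_cast
  ring

/-- The part of the weight of the cell `p` that moves to the cell `p'` when `s` is read:
the matrix `upd s ⊗ upd s`, replaced by zero if `s` is final. -/
def weight (s : S) (p p' : d × d) : ℕ :=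
  if L.final s then 0 else L.upd s p'.1 p.1 * L.upd s p'.2 p.2

variable [Fintype S]

/-- A bound for the absolute values of the coefficients of the quadratic forms. -/
def formBound : ℕ := ∑ s, ∑ p, (L.form s p).natAbs

/-- A third of the common denominator of the transition probabilities. -/
def scale : ℕ := L.formBound + ∑ s, ∑ p, ∑ p', L.weight s p p' + 1

/-- A third of the weight that is sent to the two sinks when `s` is read. -/
def share (s : S) : ℕ := if L.final s then L.scale else L.formBound

theorem scale_pos : 0 < L.scale := Nat.succ_pos _

theorem natAbs_form_le (s : S) (p : d × d) : (L.form s p).natAbs ≤ L.share s := by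
  have h : (L.form s p).natAbs ≤ L.formBound :=
    (Finset.single_le_sum (f := fun p => (L.form s p).natAbs) (fun _ _ => Nat.zero_le _)
      (Finset.mem_univ p)).trans
    (Finset.single_le_sum (f := fun s => ∑ p, (L.form s p).natAbs) (fun _ _ => Nat.zero_le _)
      (Finset.mem_univ s))
  rw [share]
  split_ifs
  · rw [scale]; omega
  · exact h

theorem sum_weight_add_share_le (s : S) (p : d × d) :
    ∑ p', L.weight s p p' + 3 * L.share s ≤ 3 * L.scale := by
  by_cases hf : L.final s
  · simp [weight, share, hf]
  · have h : ∑ p', L.weight s p p' ≤ ∑ s, ∑ p, ∑ p', L.weight s p p' :=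
      (Finset.single_le_sum (f := fun p => ∑ p', L.weight s p p') (fun _ _ => Nat.zero_le _)
        (Finset.mem_univ p)).trans
      (Finset.single_le_sum (f := fun s => ∑ p, ∑ p', L.weight s p p') (fun _ _ => Nat.zero_le _)
        (Finset.mem_univ s))
    rw [share, if_neg hf, scale]
    omega

/-- The states of the automaton besides the cells. -/
inductive Aux
  | start
  | wait
  | acc
  | rej
  deriving DecidableEq

instance : Fintype Aux := ⟨{.start, .wait, .acc, .rej}, by rintro ⟨⟩ <;> simp⟩

/-- The states of the automaton: one cell for every entry of the matrix `x ⊗ x`, and the auxiliary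
states. -/
abbrev State (d : Type) : Type := (d × d) ⊕ Aux

theorem sum_state {M : Type} [AddCommMonoid M] (f : State d → M) :
    ∑ q, f q = ∑ p, f (.inl p) +
      (f (.inr .start) + f (.inr .wait) + f (.inr .acc) + f (.inr .rej)) := by
  rw [Fintype.sum_sum_type]
  rw [show (Finset.univ : Finset Aux) = {.start, .wait, .acc, .rej} from rfl]
  simp [add_assoc]

/-- The transition probabilities, as fractions. The initial vector `x` occurs only in the row of
`start`. The truncated subtractions in the row of a cell are exact, by `natAbs_form_le` and
`sum_weight_add_share_le`. -/
def entry (x : d → ℕ) (s : S) : State d → State d → ℕ × ℕ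
  | .inr .start, .inl p => (x p.1 * x p.2, 1 + ∑ p : d × d, x p.1 * x p.2)
  | .inr .start, .inr .wait => (1, 1 + ∑ p : d × d, x p.1 * x p.2)
  | .inr .start, _ => (0, 1)
  | .inl p, .inl p' => (L.weight s p p', 3 * L.scale)
  | .inl _, .inr .start => (0, 1)
  | .inl p, .inr .wait => (3 * L.scale - 3 * L.share s - ∑ p', L.weight s p p', 3 * L.scale)
  | .inl p, .inr .acc => ((2 * L.share s - L.form s p).toNat, 3 * L.scale)
  | .inl p, .inr .rej => ((L.share s + L.form s p).toNat, 3 * L.scale)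
  | .inr .wait, .inr .wait => if L.final s then (0, 1) else (1, 1)
  | .inr .wait, .inr .acc => if L.final s then (2, 3) else (0, 1)
  | .inr .wait, .inr .rej => if L.final s then (1, 3) else (0, 1)
  | .inr .wait, _ => (0, 1)
  | .inr .acc, .inr .acc => (1, 1)
  | .inr .acc, _ => (0, 1)
  | .inr .rej, .inr .rej => (1, 1)
  | .inr .rej, _ => (0, 1)

/-- The value of the fraction `entry`. -/
noncomputable def prob (x : d → ℕ) (s : S) (q q' : State d) : ℝ :=
  ((L.entry x s q q').1 : ℝ) / ((L.entry x s q q').2 : ℝ)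

theorem entry_snd_ne_zero (x : d → ℕ) (s : S) (q q' : State d) : (L.entry x s q q').2 ≠ 0 := by
  have := L.scale_pos
  rcases q with p | _ | _ | _ | _ <;> rcases q' with p' | _ | _ | _ | _ <;>
    simp only [entry] <;> (try split_ifs) <;> simp <;> omega

theorem prob_wait (s : S) (x : d → ℕ) (p : d × d) :
    L.prob x s (.inl p) (.inr .wait) =
      (3 * L.scale - 3 * L.share s - ∑ p', (L.weight s p p' : ℝ)) / (3 * L.scale) := by
  have h := L.sum_weight_add_share_le s p
  rw [prob, entry, Nat.cast_sub (by omega), Nat.cast_sub (by omega)]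
  push_cast
  rfl

theorem prob_acc (s : S) (x : d → ℕ) (p : d × d) :
    L.prob x s (.inl p) (.inr .acc) = (2 * L.share s - L.form s p) / (3 * L.scale) := by
  have h := L.natAbs_form_le s p
  have h1 : (((2 * L.share s - L.form s p).toNat : ℤ) : ℝ) = 2 * L.share s - L.form s p := by
    rw [Int.toNat_of_nonneg (by omega)]; push_cast; rfl
  rw [prob, entry, ← h1]
  push_cast
  rfl

theorem prob_rej (s : S) (x : d → ℕ) (p : d × d) :
    L.prob x s (.inl p) (.inr .rej) = (L.share s + L.form s p) / (3 * L.scale) := by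
  have h := L.natAbs_form_le s p
  have h1 : (((L.share s + L.form s p).toNat : ℤ) : ℝ) = L.share s + L.form s p := by
    rw [Int.toNat_of_nonneg (by omega)]; push_cast; rfl
  rw [prob, entry, ← h1]
  push_cast
  rfl

theorem scale_ne_zero : (L.scale : ℝ) ≠ 0 := Nat.cast_ne_zero.2 L.scale_pos.ne'

theorem sum_prob_start (x : d → ℕ) (s : S) :
    ∑ p, L.prob x s (.inr .start) (.inl p) + L.prob x s (.inr .start) (.inr .wait) = 1 := by
  have h : (1 + ∑ p : d × d, (x p.1 : ℝ) * x p.2) ≠ 0 := by positivity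
  simp only [prob, entry, ← Finset.sum_div]
  push_cast
  rw [← add_div, add_comm, div_self h]

theorem sum_prob (x : d → ℕ) (s : S) (q : State d) : ∑ q', L.prob x s q q' = 1 := by
  rw [sum_state]
  rcases q with p | _ | _ | _ | _
  · rw [prob_wait, prob_acc, prob_rej]
    have := L.scale_ne_zero
    simp only [prob, entry, ← Finset.sum_div]
    field_simp
    push_cast
    ring
  · have := L.sum_prob_start x s
    simp only [prob, entry] at this ⊢
    simpa using this
  · by_cases hf : L.final s <;> simp [prob, entry, hf]
    norm_num
  · simp [prob, entry]
  · simp [prob, entry]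

/-- The probabilistic automaton that is attached to a guarded system with initial vector `x`. -/
noncomputable def automaton (x : d → ℕ) : ProbAutomaton (State d) S where
  init := .inr .start
  M := L.prob x
  nonneg _ _ _ := div_nonneg (Nat.cast_nonneg _) (Nat.cast_nonneg _)
  sum_eq_one := L.sum_prob x

theorem isAbsorbing_acc (x : d → ℕ) : (L.automaton x).IsAbsorbing (.inr .acc) := by
  intro s
  simp [automaton, prob, entry]

/-- The fraction of its mass that a state finally contributes to `acc` if no guard is violated and
a final letter is read. -/
noncomputable def worth : State d → ℝ
  | .inr .acc => 1
  | .inr .rej => 0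
  | _ => 2 / 3

/-- The expected loss of worth when `s` is read in the given state. -/
noncomputable def loss (s : S) : State d → ℝ
  | .inl p => L.form s p / (3 * L.scale)
  | .inr _ => 0

/-- In every state the expected worth is preserved, up to the correction for violated guards. -/
theorem sum_prob_mul_worth (x : d → ℕ) (s : S) (q : State d) :
    ∑ q', L.prob x s q q' * worth q' = worth q - L.loss s q := by
  rw [sum_state]
  rcases q with p | _ | _ | _ | _
  · rw [prob_wait, prob_acc]
    have := L.scale_ne_zero
    simp only [prob, entry, worth, ← Finset.sum_mul, ← Finset.sum_div, loss]
    field_simp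
    push_cast
    ring
  · have := L.sum_prob_start x s
    simp only [worth, ← Finset.sum_mul, loss]
    simp only [prob, entry] at this ⊢
    simp only [Nat.cast_zero, zero_div, zero_mul, add_zero, zero_add, ← add_mul, this]
    norm_num
  · by_cases hf : L.final s <;> simp [prob, entry, hf, worth, loss]
  · simp [prob, entry, worth, loss]
  · simp [prob, entry, worth, loss]

variable [DecidableEq d] (x : d → ℕ) (w : ℕ → S)

/-- The total worth of the states at time `t`. -/
noncomputable def value (t : ℕ) : ℝ := ∑ q, (L.automaton x).mass w t q * worth q

theorem value_zero : L.value x w 0 = 2 / 3 := by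
  simp [value, ProbAutomaton.mass, automaton, worth]

theorem value_succ (t : ℕ) : L.value x w (t + 1) =
    L.value x w t - ∑ p, (L.automaton x).mass w t (.inl p) * (L.form (w t) p / (3 * L.scale)) := by
  have h : L.value x w (t + 1) =
      ∑ q, (L.automaton x).mass w t q * (worth q - L.loss (w t) q) := by
    simp only [value, ProbAutomaton.mass, Finset.sum_mul]
    rw [Finset.sum_comm]
    simp only [mul_assoc, ← Finset.mul_sum]
    simp only [← L.sum_prob_mul_worth x]
    rfl
  rw [h]
  simp only [mul_sub, Finset.sum_sub_distrib, value]
  rw [sum_state (fun q => _ * L.loss (w t) q)]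
  simp [loss]


theorem mass_start_succ (t : ℕ) : (L.automaton x).mass w (t + 1) (.inr .start) = 0 := by
  refine Finset.sum_eq_zero fun q _ => ?_
  rcases q with p | _ | _ | _ | _ <;> simp [automaton, prob, entry]

theorem mass_cell_succ (t : ℕ) (ht : (L.automaton x).mass w t (.inr .start) = 0) (p' : d × d) :
    (L.automaton x).mass w (t + 1) (.inl p') =
      ∑ p, (L.automaton x).mass w t (.inl p) * (L.weight (w t) p p' / (3 * L.scale)) := by
  rw [ProbAutomaton.mass, sum_state, ht]
  simp [automaton, prob, entry]

theorem mass_wait_succ (t : ℕ) (ht : (L.automaton x).mass w t (.inr .start) = 0) :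
    (L.automaton x).mass w (t + 1) (.inr .wait) =
      ∑ p, (L.automaton x).mass w t (.inl p) *
        ((3 * L.scale - 3 * L.share (w t) - ∑ p', (L.weight (w t) p p' : ℝ)) / (3 * L.scale)) +
      (L.automaton x).mass w t (.inr .wait) * (if L.final (w t) then 0 else 1) := by
  rw [ProbAutomaton.mass, sum_state, ht]
  simp only [← L.prob_wait _ x]
  by_cases hf : L.final (w t) <;> simp [automaton, prob, entry, hf]

theorem mass_one_cell (p : d × d) : (L.automaton x).mass w 1 (.inl p) =
    (x p.1 * x p.2) / (1 + ∑ p : d × d, (x p.1 : ℝ) * x p.2) := by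
  rw [ProbAutomaton.mass, sum_state]
  simp [ProbAutomaton.mass, automaton, prob, entry]

theorem mass_one_wait : (L.automaton x).mass w 1 (.inr .wait) =
    1 / (1 + ∑ p : d × d, (x p.1 : ℝ) * x p.2) := by
  rw [ProbAutomaton.mass, sum_state]
  simp [ProbAutomaton.mass, automaton, prob, entry]

theorem mass_wait_le (t : ℕ) (hf : L.final (w (t + 1)) = false) :
    (L.automaton x).mass w (t + 1) (.inr .wait) ≤ (L.automaton x).mass w (t + 2) (.inr .wait) := by
  rw [L.mass_wait_succ x w (t + 1) (L.mass_start_succ x w t), hf]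
  simp only [Bool.false_eq_true, if_false, mul_one, le_add_iff_nonneg_left]
  refine Finset.sum_nonneg fun p _ => mul_nonneg ((L.automaton x).mass_nonneg _ _ _) ?_
  rw [← L.prob_wait _ x]
  exact (L.automaton x).nonneg _ _ _

/-- While no final letter is read, the cells hold a multiple of `x ⊗ x`. -/
theorem mass_cell (t : ℕ) (hf : ∀ i < t, L.final (w (i + 1)) = false) (p : d × d) :
    (L.automaton x).mass w (t + 1) (.inl p) =
      (1 / (1 + ∑ p : d × d, (x p.1 : ℝ) * x p.2) / (3 * L.scale) ^ t) *
        (L.run (fun i => w (i + 1)) x t p.1 * L.run (fun i => w (i + 1)) x t p.2) := by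
  induction t generalizing p with
  | zero => rw [mass_one_cell, run]; ring
  | succ t ih =>
    have hw : ∀ q, L.weight (w (t + 1)) q p =
        L.upd (w (t + 1)) p.1 q.1 * L.upd (w (t + 1)) p.2 q.2 := by
      intro q
      rw [weight, hf t (Nat.lt_succ_self t)]
      rfl
    rw [L.mass_cell_succ x w (t + 1) (L.mass_start_succ x w t)]
    simp only [ih fun i hi => hf i (by omega), hw]
    rw [run]
    simp only [mulVec, dotProduct, Nat.cast_sum, Nat.cast_mul]
    rw [Finset.sum_mul_sum, Fintype.sum_prod_type, Finset.mul_sum]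
    refine Finset.sum_congr rfl fun i _ => ?_
    rw [Finset.mul_sum]
    refine Finset.sum_congr rfl fun j _ => ?_
    have := L.scale_ne_zero
    field_simp
    ring

/-- While no final letter is read, `wait` keeps the mass that it received from `start`. -/
theorem mass_wait_ge (t : ℕ) (hf : ∀ i < t, L.final (w (i + 1)) = false) :
    1 / (1 + ∑ p : d × d, (x p.1 : ℝ) * x p.2) ≤ (L.automaton x).mass w (t + 1) (.inr .wait) := by
  induction t with
  | zero => rw [mass_one_wait]
  | succ t ih =>
    exact (ih fun i hi => hf i (by omega)).trans (L.mass_wait_le x w t (hf t (by omega)))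

theorem value_one : L.value x w 1 = 2 / 3 := by
  rw [value_succ, value_zero]
  simp [ProbAutomaton.mass, automaton]

/-- The letter at time `t + 1` acts on the vector at time `t`, since the letter at time `0` is spent
on leaving `start`. -/
theorem value_step (t : ℕ) (hf : ∀ i < t, L.final (w (i + 1)) = false) :
    L.value x w (t + 2) = L.value x w (t + 1) -
      1 / (1 + ∑ p : d × d, (x p.1 : ℝ) * x p.2) / (3 * L.scale) ^ (t + 1) *
        L.err (w (t + 1)) (L.run (fun i => w (i + 1)) x t) := by
  rw [value_succ, ← sum_form, Finset.mul_sum]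
  congr 1
  refine Finset.sum_congr rfl fun p _ => ?_
  rw [L.mass_cell x w t hf]
  have := L.scale_ne_zero
  field_simp
  ring

/-- The letters at the times `1, …, t - 1` must not be final, the one at time `t` may be. -/
theorem value_le (t : ℕ) (hf : ∀ i, i + 1 < t → L.final (w (i + 1)) = false) :
    L.value x w (t + 1) ≤ 2 / 3 ∧
      (L.value x w (t + 1) = 2 / 3 ↔
        ∀ i < t, L.Ok (w (i + 1)) (L.run (fun i => w (i + 1)) x i)) := by
  induction t with
  | zero => simp [value_one]
  | succ t ih =>
    have hf' : ∀ i < t, L.final (w (i + 1)) = false := fun i hi => hf i (by omega)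
    obtain ⟨h1, h2⟩ := ih fun i hi => hf i (by omega)
    have hc : 0 < 1 / (1 + ∑ p : d × d, (x p.1 : ℝ) * x p.2) / (3 * L.scale) ^ (t + 1) := by
      have := Nat.cast_pos (α := ℝ).2 L.scale_pos
      positivity
    have he := L.err_nonneg (w (t + 1)) (L.run (fun i => w (i + 1)) x t)
    rw [value_step L x w t hf']
    set c := 1 / (1 + ∑ p : d × d, (x p.1 : ℝ) * x p.2) / (3 * L.scale) ^ (t + 1)
    have hce := mul_nonneg hc.le he
    refine ⟨by linarith, ?_⟩
    rw [Nat.forall_lt_succ_right, ← h2, ← L.err_eq_zero]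
    constructor
    · intro h
      have h0 : c * L.err (w (t + 1)) (L.run (fun i => w (i + 1)) x t) = 0 := by linarith
      exact ⟨by linarith, (mul_eq_zero.1 h0).resolve_left hc.ne'⟩
    · rintro ⟨h3, h4⟩
      rw [h3, h4, mul_zero, sub_zero]

theorem value_eq (t : ℕ) : L.value x w t = (L.automaton x).mass w t (.inr .acc) +
    2 / 3 * (∑ p, (L.automaton x).mass w t (.inl p) + (L.automaton x).mass w t (.inr .start) +
      (L.automaton x).mass w t (.inr .wait)) := by
  rw [value, sum_state]
  simp only [worth, ← Finset.sum_mul]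
  ring

/-- As long as no final letter is read, the mass of `wait` is lost for `acc`. -/
theorem mass_acc_le (t : ℕ) (hf : ∀ i < t, L.final (w (i + 1)) = false) :
    (L.automaton x).mass w (t + 1) (.inr .acc) ≤
      2 / 3 - 2 / 3 * (1 / (1 + ∑ p : d × d, (x p.1 : ℝ) * x p.2)) := by
  have h1 := (L.value_le x w t fun i hi => hf i (by omega)).1
  have h2 := L.mass_wait_ge x w t hf
  rw [value_eq, mass_start_succ] at h1
  have h3 : 0 ≤ ∑ p, (L.automaton x).mass w (t + 1) (.inl p) :=
    Finset.sum_nonneg fun p _ => (L.automaton x).mass_nonneg _ _ _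
  linarith

/-- A final letter empties all states but the two sinks. -/
theorem mass_after_final (t : ℕ) (hf : L.final (w (t + 1)) = true) (n : ℕ) :
    (∀ p, (L.automaton x).mass w (t + 2 + n) (.inl p) = 0) ∧
      (L.automaton x).mass w (t + 2 + n) (.inr .wait) = 0 := by
  induction n with
  | zero =>
    have h0 := L.mass_start_succ x w t
    constructor
    · intro p
      rw [add_zero, L.mass_cell_succ x w (t + 1) h0]
      simp [weight, hf]
    · rw [add_zero, L.mass_wait_succ x w (t + 1) h0]
      simp [weight, share, hf]
  | succ n ih =>
    have h0 : (L.automaton x).mass w (t + 2 + n) (.inr .start) = 0 := by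
      rw [show t + 2 + n = t + 1 + n + 1 by omega]
      exact L.mass_start_succ x w _
    constructor
    · intro p
      rw [← add_assoc, L.mass_cell_succ x w _ h0]
      simp [ih.1]
    · rw [← add_assoc, L.mass_wait_succ x w _ h0]
      simp [ih.1, ih.2]

theorem mass_acc_after_final (t : ℕ) (hf : L.final (w (t + 1)) = true) (n : ℕ) :
    (L.automaton x).mass w (t + 2 + n) (.inr .acc) = L.value x w (t + 2) := by
  induction n with
  | zero =>
    rw [value_eq, L.mass_start_succ x w (t + 1)]
    obtain ⟨h1, h2⟩ := L.mass_after_final x w t hf 0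
    rw [add_zero] at h1 h2
    simp [h1, h2]
  | succ n ih =>
    obtain ⟨h1, h2⟩ := L.mass_after_final x w t hf n
    have h0 : (L.automaton x).mass w (t + 2 + n) (.inr .start) = 0 := by
      rw [show t + 2 + n = t + 1 + n + 1 by omega]
      exact L.mass_start_succ x w _
    rw [← ih, ← add_assoc, ProbAutomaton.mass, sum_state]
    simp only [h0, h1, h2, zero_mul, Finset.sum_const_zero, zero_add]
    simp [automaton, prob, entry]

/-- A guarded system accepts `x` if and only if some infinite word leads to `acc` with
probability `2 / 3`. -/
theorem accepts_iff_tendsto : L.Accepts x ↔ ∃ w : ℕ → S,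
    Filter.Tendsto (fun t => (L.automaton x).mass w t (.inr .acc)) Filter.atTop
      (nhds (2 / 3)) := by
  have key : ∀ (w : ℕ → S) (T : ℕ), L.final (w (T + 1)) = true →
      (∀ i < T, L.final (w (i + 1)) = false) →
      Filter.Tendsto (fun t => (L.automaton x).mass w t (.inr .acc)) Filter.atTop
        (nhds (L.value x w (T + 2))) := by
    intro w T hT hf
    refine tendsto_const_nhds.congr' ?_
    filter_upwards [Filter.eventually_ge_atTop (T + 2)] with t ht
    obtain ⟨n, rfl⟩ := Nat.exists_eq_add_of_le ht
    exact (L.mass_acc_after_final x w T hT n).symm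
  rw [accepts_iff]
  constructor
  · rintro ⟨u, T, h1, h2, h3⟩
    -- The letter at time `0` is arbitrary.
    let w : ℕ → S := fun t => t.casesOn (u 0) u
    have hv : L.value x w (T + 2) = 2 / 3 :=
      (L.value_le x w (T + 1) fun i hi => h2 i (by omega)).2.2 fun i hi => h3 i (by omega)
    exact ⟨w, hv ▸ key w T h1 h2⟩
  · rintro ⟨w, h⟩
    by_cases hex : ∃ T, L.final (w (T + 1)) = true
    · classical
      have hmin : ∀ i < Nat.find hex, L.final (w (i + 1)) = false := fun i hi => by
        simpa using Nat.find_min hex hi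
      have hv := tendsto_nhds_unique (key w _ (Nat.find_spec hex) hmin) h
      refine ⟨fun i => w (i + 1), Nat.find hex, Nat.find_spec hex, hmin, fun i hi => ?_⟩
      exact (L.value_le x w (Nat.find hex + 1) fun i hi => hmin i (by omega)).2.1 hv i (by omega)
    · have hf : ∀ i, L.final (w (i + 1)) = false := fun i => by
        simpa using fun hi => hex ⟨i, hi⟩
      have hle := le_of_tendsto ((Filter.tendsto_add_atTop_iff_nat 1).2 h)
        (Filter.Eventually.of_forall fun t => L.mass_acc_le x w t fun i _ => hf i)
      have hpos : 0 < 1 / (1 + ∑ p : d × d, (x p.1 : ℝ) * x p.2) := by positivity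
      linarith

end GuardedSystem

/-! ### Stack machines as guarded systems -/

/-- A machine with control states `C` and stacks `K` over the alphabet `Γ`. In the control state
`c` it pops the topmost symbol `r` of `stack c` (`none` if that stack is empty), pushes the list
`repl c r` instead, and goes to `next c r`. -/
structure StackMachine (C K Γ : Type) where
  stack : C → K
  next : C → Option Γ → C
  repl : C → Option Γ → List Γ
  halt : C → Bool

namespace StackMachine

open Matrix

variable {C K Γ : Type}

section Encoding

variable [Fintype Γ]

/-- The digit of a symbol; the digit `0` is reserved for the bottom of a stack. -/
noncomputable def digit : Option Γ → ℕ
  | none => 0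
  | some a => Fintype.equivFin Γ a + 1

variable (Γ) in
/-- The base in which stacks are written as numbers. -/
def base : ℕ := Fintype.card Γ + 1

/-- The number with the symbols of a stack as digits, the topmost symbol being the least
significant digit. -/
noncomputable def enc : List Γ → ℕ
  | [] => 0
  | a :: l => digit (some a) + base Γ * enc l

theorem digit_lt (r : Option Γ) : digit r < base Γ := by
  cases r with
  | none => exact Nat.succ_pos _
  | some a => exact Nat.succ_lt_succ (Fintype.equivFin Γ a).2

theorem digit_injective : Function.Injective (digit (Γ := Γ)) := by
  rintro (_ | a) (_ | b) h
  · rfl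
  · simp [digit] at h
  · simp [digit] at h
  · simp only [digit, add_left_inj] at h
    rw [(Fintype.equivFin Γ).injective (Fin.ext h)]

theorem enc_eq (l : List Γ) : enc l = digit l.head? + base Γ * enc l.tail := by
  cases l <;> simp [enc, digit]

/-- Since `0` is not the digit of a symbol, a representation `digit r + base Γ * y` determines
whether the stack is empty. -/
theorem enc_eq_iff (l : List Γ) (r : Option Γ) (y : ℕ) :
    enc l = digit r + base Γ * y ↔ r = l.head? ∧ y = enc l.tail := by
  constructor
  · intro h
    rw [enc_eq] at h
    have hm := congrArg (· % base Γ) h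
    simp only [Nat.add_mul_mod_self_left, Nat.mod_eq_of_lt (digit_lt _)] at hm
    have hr := digit_injective hm
    subst hr
    exact ⟨rfl, (Nat.eq_of_mul_eq_mul_left (Nat.succ_pos _) (Nat.add_left_cancel h)).symm⟩
  · rintro ⟨rfl, rfl⟩
    exact enc_eq l

theorem enc_append (l l' : List Γ) : enc (l ++ l') = enc l + base Γ ^ l.length * enc l' := by
  induction l with
  | nil => simp [enc]
  | cons a l ih =>
    rw [List.cons_append, enc, enc, ih, List.length_cons]
    ring

end Encoding

variable [DecidableEq K] (A : StackMachine C K Γ)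

/-- One step on configurations, with result `none` in halting control states. -/
def step : C × (K → List Γ) → Option (C × (K → List Γ))
  | (c, T) =>
    if A.halt c then none
    else some (A.next c (T (A.stack c)).head?,
      Function.update T (A.stack c) (A.repl c (T (A.stack c)).head? ++ (T (A.stack c)).tail))

/-- The registers besides the stacks: the constant one, the control state, and a scratch
register. -/
inductive Counter
  | one
  | ctl
  | tmp
  deriving DecidableEq

instance : Fintype Counter := ⟨{.one, .ctl, .tmp}, by rintro ⟨⟩ <;> simp⟩

/-- The registers: one for every stack, and the counters. -/
abbrev Reg (K : Type) : Type := K ⊕ Counter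

variable [Fintype Γ] (code : C → ℕ)

/-- The register contents that represent a configuration. -/
noncomputable def regs (z : C × (K → List Γ)) (y : ℕ) : Reg K → ℕ
  | .inl k => enc (z.2 k)
  | .inr .one => 1
  | .inr .ctl => code z.1
  | .inr .tmp => y

/-- The letter `none` increments the scratch register. The letter `some (c, r)` executes the step
of the control state `c` for the topmost symbol `r`; its guards force `c` and `r` to be the actual
ones, and the scratch register to hold the number of the popped stack. -/
noncomputable def system (F : Finset C) : GuardedSystem (Reg K) (Option (F × Option Γ)) Bool where
  upd
    | none, i => Pi.single i 1 + if i = .inr .tmp then Pi.single (.inr .one) 1 else 0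
    | some (c, r), .inl k =>
      if k = A.stack c then
        Pi.single (.inr .one) (enc (A.repl c r)) +
          Pi.single (.inr .tmp) (base Γ ^ (A.repl c r).length)
      else Pi.single (.inl k) 1
    | some _, .inr .one => Pi.single (.inr .one) 1
    | some (c, r), .inr .ctl => Pi.single (.inr .one) (code (A.next c r))
    | some _, .inr .tmp => 0
  lhs
    | none, _ => 0
    | some _, true => Pi.single (.inr .ctl) 1
    | some (c, _), false => Pi.single (.inl (A.stack c)) 1
  rhs
    | none, _ => 0
    | some (c, _), true => Pi.single (.inr .one) (code c)
    | some (_, r), false =>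
      Pi.single (.inr .one) (digit r) + Pi.single (.inr .tmp) (base Γ)
  final
    | none => false
    | some (c, _) => A.halt c

variable [Fintype K] (F : Finset C)

theorem upd_none (z : C × (K → List Γ)) (y : ℕ) :
    (A.system code F).upd none *ᵥ regs code z y = regs code z (y + 1) := by
  funext i
  change (A.system code F).upd none i ⬝ᵥ _ = _
  rcases i with k | _ | _ | _ <;> simp [system, add_dotProduct, regs]

theorem ok_none (x : Reg K → ℕ) : (A.system code F).Ok none x := fun _ => rfl

theorem ok_some (z : C × (K → List Γ)) (y : ℕ) (c : F) (r : Option Γ) :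
    (A.system code F).Ok (some (c, r)) (regs code z y) ↔
      code z.1 = code c ∧ r = (z.2 (A.stack c)).head? ∧ y = enc (z.2 (A.stack c)).tail := by
  rw [GuardedSystem.Ok, Bool.forall_bool, and_comm, ← enc_eq_iff]
  simp [system, add_dotProduct, regs]

/-- If the letter is the one that the guards force, its matrix performs the step of the machine. -/
theorem upd_some (z : C × (K → List Γ)) (c : F) (hc : z.1 = c) (h : A.halt c = false) :
    ∃ z', A.step z = some z' ∧
      (A.system code F).upd (some (c, (z.2 (A.stack c)).head?)) *ᵥ
        regs code z (enc (z.2 (A.stack c)).tail) = regs code z' 0 := by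
  obtain ⟨c', T⟩ := z
  obtain rfl : c' = c := hc
  refine ⟨_, if_neg (by simp [h]), ?_⟩
  funext i
  change (A.system code F).upd (some (c, _)) i ⬝ᵥ _ = _
  rcases i with k | _ | _ | _
  · by_cases hk : k = A.stack c
    · subst hk
      simp [system, add_dotProduct, regs, enc_append]
    · simp [system, regs, hk]
  · simp [system, regs]
  · simp [system, regs]
  · simp [system, regs]

/-- The scratch register can be filled by increments before a letter is read. -/
theorem accepts_of_accepts_tmp (z : C × (K → List Γ)) (y : ℕ)
    (h : (A.system code F).Accepts (regs code z y)) :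
    (A.system code F).Accepts (regs code z 0) := by
  induction y with
  | zero => exact h
  | succ y ih =>
    refine ih (.step (A.ok_none code F _) rfl ?_)
    rwa [upd_none]

/-- The guarded system accepts the representations of exactly those configurations from which the
stack machine halts. -/
theorem accepts_iff_dom (hinj : Set.InjOn code F)
    (hF : ∀ c ∈ F, ∀ r, A.next c r ∈ F) (z : C × (K → List Γ)) (hz : z.1 ∈ F) :
    (A.system code F).Accepts (regs code z 0) ↔ (StateTransition.eval A.step z).Dom := by
  constructor
  · suffices H : ∀ x, (A.system code F).Accepts x → ∀ z y, z.1 ∈ F → x = regs code z y →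
        (StateTransition.eval A.step z).Dom from fun h => H _ h z 0 hz rfl
    intro x hx
    induction hx with
    | @final s x hok hf =>
      rintro z y hz rfl
      rcases s with _ | ⟨c, r⟩
      · cases hf
      · obtain ⟨h1, -⟩ := (A.ok_some code F z y c r).1 hok
        have hc : z.1 = c := hinj hz c.2 h1
        have hf : A.halt c = true := hf
        refine Part.dom_iff_mem.2 ⟨z, StateTransition.mem_eval.2 ⟨.refl, ?_⟩⟩
        rw [← hc] at hf
        simp [step, hf]
    | @step s x hok hf _ ih =>
      rintro z y hz rfl
      rcases s with _ | ⟨c, r⟩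
      · exact ih z (y + 1) hz (upd_none A code F z y)
      · obtain ⟨h1, rfl, rfl⟩ := (A.ok_some code F z y c r).1 hok
        have hc : z.1 = c := hinj hz c.2 h1
        obtain ⟨z', h2, h3⟩ := A.upd_some code F z c hc hf
        rw [StateTransition.reaches_eval (Relation.ReflTransGen.single h2)]
        refine ih z' 0 ?_ h3
        simp only [step] at h2
        split_ifs at h2
        cases h2
        exact hF _ hz _
  · intro h
    obtain ⟨b, hb⟩ := Part.dom_iff_mem.1 h
    obtain ⟨hr, hnone⟩ := StateTransition.mem_eval.1 hb
    clear hb h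
    induction hr using Relation.ReflTransGen.head_induction_on with
    | refl =>
      have hh : A.halt b.1 = true := by
        by_contra hcon
        simp [step, hcon] at hnone
      let s : Option (F × Option Γ) := some (⟨b.1, hz⟩, (b.2 (A.stack b.1)).head?)
      refine A.accepts_of_accepts_tmp code F b (enc (b.2 (A.stack b.1)).tail)
        (.final (s := s) ?_ hh)
      exact (A.ok_some code F _ _ _ _).2 ⟨rfl, rfl, rfl⟩
    | @head a a' h1 _ ih =>
      have hh : A.halt a.1 = false := by
        by_contra hcon
        simp only [Bool.not_eq_false] at hcon
        simp [step, hcon] at h1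
      obtain ⟨z', h2, h3⟩ := A.upd_some code F a ⟨a.1, hz⟩ rfl hh
      obtain rfl : z' = a' := Option.some.inj (h2.symm.trans h1)
      let s : Option (F × Option Γ) := some (⟨a.1, hz⟩, (a.2 (A.stack a.1)).head?)
      refine A.accepts_of_accepts_tmp code F a (enc (a.2 (A.stack a.1)).tail)
        (.step (s := s) ?_ hh ?_)
      · exact (A.ok_some code F _ _ _ _).2 ⟨rfl, rfl, rfl⟩
      · change (A.system code F).Accepts ((A.system code F).upd (some (⟨a.1, hz⟩, _)) *ᵥ _)
        rw [h3]
        refine ih ?_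
        simp only [step, hh] at h2
        cases h2
        exact hF _ hz _

end StackMachine

/-! ### Programs with stacks as stack machines -/

namespace Turing.TM2

open Stmt StateTransition

variable {K Γ Λ σ : Type} (M : Λ → Stmt (fun _ : K => Γ) Λ σ)

/-- The rest of a statement and the local store after its first instruction was executed with
topmost symbol `r`; a jump continues with the statement at the new label. -/
def afterHead : Option (Stmt (fun _ : K => Γ) Λ σ) → σ → Option Γ →
    Option (Stmt (fun _ : K => Γ) Λ σ) × σ
  | some (push _ _ q), v, _ => (some q, v)
  | some (peek _ f q), v, r => (some q, f v r)
  | some (pop _ f q), v, r => (some q, f v r)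
  | some (load a q), v, _ => (some q, a v)
  | some (branch f q₁ q₂), v, _ => (some (cond (f v) q₁ q₂), v)
  | some (goto f), v, _ => (some (M (f v)), v)
  | some halt, v, _ => (none, v)
  | none, v, _ => (none, v)

/-- Only the finitely many statements that occur at the labels in `S` are ever executed. -/
theorem afterHead_mem [Inhabited Λ] {S : Finset Λ} (hS : Supports M S)
    (q : Option (Stmt (fun _ : K => Γ) Λ σ)) (hq : q ∈ stmts M S) (v : σ) (r : Option Γ) :
    (afterHead M q v r).1 ∈ stmts M S := by
  rcases q with _ | ⟨k, f, q⟩ | ⟨k, f, q⟩ | ⟨k, f, q⟩ | ⟨a, q⟩ | ⟨f, q₁, q₂⟩ | f | _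
  · exact hq
  · exact stmts_trans (by simp [stmts₁, stmts₁_self]) hq
  · exact stmts_trans (by simp [stmts₁, stmts₁_self]) hq
  · exact stmts_trans (by simp [stmts₁, stmts₁_self]) hq
  · exact stmts_trans (by simp [stmts₁, stmts₁_self]) hq
  · refine stmts_trans ?_ hq
    cases f v <;> simp [stmts₁, stmts₁_self]
  · have h := stmts_supportsStmt hS hq v
    simp only [afterHead, stmts, Finset.mem_insertNone, Finset.mem_biUnion, Option.mem_def,
      Option.some.injEq, forall_eq']
    exact ⟨_, h, stmts₁_self⟩
  · simp [afterHead, stmts]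

variable [Inhabited K]

/-- The stack that is inspected by the first instruction of a statement. -/
def headStack : Option (Stmt (fun _ : K => Γ) Λ σ) → K
  | some (push k _ _) => k
  | some (peek k _ _) => k
  | some (pop k _ _) => k
  | _ => default

/-- The symbols by which the first instruction replaces the topmost symbol `r`. -/
def headRepl : Option (Stmt (fun _ : K => Γ) Λ σ) → σ → Option Γ → List Γ
  | some (push _ f _), v, r => f v :: r.toList
  | some (pop _ _ _), _, _ => []
  | _, _, r => r.toList

/-- The stack machine that executes a `TM2` program one instruction at a time. -/
def toStackMachine : StackMachine (Option (Stmt (fun _ : K => Γ) Λ σ) × σ) K Γ where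
  stack c := headStack c.1
  next c r := afterHead M c.1 c.2 r
  repl c r := headRepl c.1 c.2 r
  halt c := c.1.isNone

variable [DecidableEq K]

/-- The configuration of `toStackMachine` that corresponds to a configuration of the program: the
label is replaced by the statement at that label. -/
def Cfg.toStackMachine (z : Cfg (fun _ : K => Γ) Λ σ) :
    (Option (Stmt (fun _ : K => Γ) Λ σ) × σ) × (K → List Γ) :=
  ((z.l.map M, z.var), z.stk)

theorem toList_head?_append_tail (l : List Γ) : l.head?.toList ++ l.tail = l := by
  cases l <;> rfl

theorem reaches₁_stepAux (q : Stmt (fun _ : K => Γ) Λ σ) (v : σ) (T : K → List Γ) :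
    Reaches₁ (toStackMachine M).step ((some q, v), T) ((stepAux q v T).toStackMachine M) := by
  induction q generalizing v T with
  | push k f q ih =>
    refine .head (b := ((some q, v), Function.update T k (f v :: T k))) ?_ (ih _ _)
    simp [StackMachine.step, toStackMachine, headStack, afterHead, headRepl,
      toList_head?_append_tail]
  | peek k f q ih =>
    refine .head (b := ((some q, f v (T k).head?), T)) ?_ (ih _ _)
    simp [StackMachine.step, toStackMachine, headStack, afterHead, headRepl,
      toList_head?_append_tail]
  | pop k f q ih =>
    refine .head (b := ((some q, f v (T k).head?), Function.update T k (T k).tail)) ?_ (ih _ _)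
    simp [StackMachine.step, toStackMachine, headStack, afterHead, headRepl]
  | load a q ih =>
    refine .head (b := ((some q, a v), T)) ?_ (ih _ _)
    simp [StackMachine.step, toStackMachine, headStack, afterHead, headRepl,
      toList_head?_append_tail]
  | branch f q₁ q₂ ih₁ ih₂ =>
    refine .head (b := ((some (cond (f v) q₁ q₂), v), T)) ?_ ?_
    · simp [StackMachine.step, toStackMachine, headStack, afterHead, headRepl,
        toList_head?_append_tail]
    · rw [stepAux]
      cases f v
      · exact ih₂ _ _
      · exact ih₁ _ _
  | goto f =>
    refine .single ?_
    simp [StackMachine.step, toStackMachine, headStack, afterHead, headRepl,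
      toList_head?_append_tail, Cfg.toStackMachine]
  | halt =>
    refine .single ?_
    simp [StackMachine.step, toStackMachine, headStack, afterHead, headRepl,
      toList_head?_append_tail, Cfg.toStackMachine]

theorem respects_toStackMachine :
    Respects (step M) (toStackMachine M).step fun a b => b = a.toStackMachine M := by
  rintro ⟨_ | l, v, T⟩ _ rfl
  · rfl
  · exact ⟨_, rfl, reaches₁_stepAux M (M l) v T⟩

end Turing.TM2

/-! ### An undecidable guarded system -/

namespace StackMachine

/-- The number in base `B` whose digits are the binary digits of the argument, starting with the
least significant one, where `b₀` and `b₁` stand for the binary digits and `e` for what follows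
the most significant one. -/
def binaryCode (b₀ b₁ e B : ℕ) : ℕ → ℕ
  | 0 => e
  | n + 1 => (if (n + 1) % 2 = 0 then b₀ else b₁) + B * binaryCode b₀ b₁ e B ((n + 1) / 2)

theorem binaryCode_bit0 (b₀ b₁ e B : ℕ) {n : ℕ} (hn : n ≠ 0) :
    binaryCode b₀ b₁ e B (n + n) = b₀ + B * binaryCode b₀ b₁ e B n := by
  obtain ⟨k, rfl⟩ := Nat.exists_eq_succ_of_ne_zero hn
  rw [show k.succ + k.succ = 2 * k + 1 + 1 by omega, binaryCode, if_pos (by omega),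
    show (2 * k + 1 + 1) / 2 = k.succ by omega]

theorem binaryCode_bit1 (b₀ b₁ e B n : ℕ) :
    binaryCode b₀ b₁ e B (n + n + 1) = b₁ + B * binaryCode b₀ b₁ e B n := by
  rw [binaryCode, if_neg (by omega), show (n + n + 1) / 2 = n by omega]

theorem computable_binaryCode (b₀ b₁ e B : ℕ) : Computable (binaryCode b₀ b₁ e B) := by
  let g : Unit → List ℕ → Option ℕ := fun _ l =>
    if l.length = 0 then some e
    else (l[l.length / 2]?).map fun y => (if l.length % 2 = 0 then b₀ else b₁) + B * y
  have hlen : Primrec fun p : Unit × List ℕ => p.2.length := Primrec.list_length.comp Primrec.snd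
  have hg : Primrec₂ g := by
    refine Primrec.ite (Primrec.eq.comp hlen (Primrec.const 0)) (Primrec.const _) ?_
    refine Primrec.option_map
      (Primrec.list_getElem?.comp Primrec.snd (Primrec.nat_div.comp hlen (Primrec.const 2))) ?_
    refine Primrec.nat_add.comp (Primrec.ite (Primrec.eq.comp (Primrec.nat_mod.comp
      (hlen.comp Primrec.fst) (Primrec.const 2)) (Primrec.const 0)) (Primrec.const _)
      (Primrec.const _)) (Primrec.nat_mul.comp (Primrec.const _) Primrec.snd)
  have h : Primrec₂ fun (_ : Unit) n => binaryCode b₀ b₁ e B n := by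
    refine Primrec.nat_strong_rec _ hg fun _ n => ?_
    cases n with
    | zero => simp [g, binaryCode]
    | succ n =>
      have : (n + 1) / 2 < n + 1 := by omega
      simp [g, binaryCode, List.getElem?_range this]
  exact (h.comp (Primrec.const ()) Primrec.id).to_comp

open Turing.PartrecToTM2 in
theorem enc_trNum (l : List Γ') (n : Num) :
    enc (trNum n ++ l) =
      binaryCode (digit (some Γ'.bit0)) (digit (some Γ'.bit1)) (enc l) (base Γ') n := by
  rcases n with _ | p
  · simp [trNum, binaryCode]
  · change enc (trPosNum p ++ l) = binaryCode _ _ _ _ (p : ℕ)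
    induction p with
    | one =>
      have h := binaryCode_bit1 (digit (some Γ'.bit0)) (digit (some Γ'.bit1)) (enc l) (base Γ') 0
      simpa [trPosNum, enc, binaryCode.eq_1] using h.symm
    | bit1 p ih =>
      rw [trPosNum, List.cons_append, enc, ih, PosNum.cast_bit1, binaryCode_bit1]
    | bit0 p ih =>
      rw [trPosNum, List.cons_append, enc, ih, PosNum.cast_bit0,
        binaryCode_bit0 _ _ _ _ (PosNum.cast_pos (α := ℕ) p).ne']

end StackMachine

section Universal

open Turing Turing.PartrecToTM2 StackMachine

instance : Fintype K' := ⟨{.main, .rev, .aux, .stack}, by rintro ⟨⟩ <;> simp⟩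

/-- A fixed program of the `TM2` model halts on an undecidable set of inputs. -/
theorem exists_code_undecidable : ∃ c : ToPartrec.Code,
    ¬ ComputablePred fun n : ℕ => (StateTransition.eval (TM2.step tr) (init c [n])).Dom := by
  -- The universal function: `n` is read as a program that is run on the input `0`.
  let f : ℕ →. ℕ := fun n => (Denumerable.ofNat Nat.Partrec.Code n).eval 0
  have hf : Partrec f :=
    Nat.Partrec.Code.eval_part.comp (Computable.ofNat Nat.Partrec.Code) (Computable.const 0)
  obtain ⟨c, hc⟩ := ToPartrec.Code.exists_code (Nat.Partrec'.part_iff₁.2 hf)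
  refine ⟨c, fun h => ComputablePred.halting_problem 0 ?_⟩
  have hdom : ∀ n, (StateTransition.eval (TM2.step tr) (init c [n])).Dom ↔ (f n).Dom := by
    intro n
    rw [tr_eval]
    have := hc ⟨[n], rfl⟩
    simp only at this
    rw [this]
    rfl
  obtain ⟨g, hg, hgf⟩ := ComputablePred.computable_iff.1 h
  refine ComputablePred.computable_iff.2
    ⟨fun c => g (Encodable.encode c), hg.comp Computable.encode, funext fun c => ?_⟩
  rw [← congrFun hgf, hdom]
  simp [f]

/-- Acceptance is undecidable for a fixed guarded system whose initial vector depends on the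
input. -/
theorem exists_guardedSystem_undecidable :
    ∃ (d S G : Type) (_ : Fintype d) (_ : DecidableEq d) (_ : Fintype S) (_ : Fintype G)
      (L : GuardedSystem d S G) (x : ℕ → d → ℕ), (∀ i, Computable fun n => x n i) ∧
        ¬ ComputablePred fun n => L.Accepts (x n) := by
  classical
  obtain ⟨c, hc⟩ := exists_code_undecidable
  let _ : Inhabited Λ' := ⟨trNormal c Cont'.halt⟩
  let supp := TM2.stmts tr (codeSupp c Cont'.halt)
  let F : Finset (Option (TM2.Stmt (fun _ : K' => Γ') Λ' (Option Γ')) × Option Γ') :=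
    supp ×ˢ Finset.univ
  have hF : ∀ z ∈ F, ∀ r, (TM2.toStackMachine tr).next z r ∈ F := fun z hz r =>
    Finset.mem_product.2 ⟨TM2.afterHead_mem tr (tr_supports c Cont'.halt) z.1
      (Finset.mem_product.1 hz).1 z.2 r, Finset.mem_univ _⟩
  obtain ⟨code, hcode⟩ : ∃ code : Option (TM2.Stmt (fun _ : K' => Γ') Λ' (Option Γ')) × Option Γ' →
      ℕ, Set.InjOn code F :=
    ⟨fun z => F.toList.idxOf z, fun a ha b _ h => (List.idxOf_inj (Finset.mem_toList.2 ha)).1 h⟩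
  let z : ℕ → (Option (TM2.Stmt (fun _ : K' => Γ') Λ' (Option Γ')) × Option Γ') ×
    (K' → List Γ') := fun n => (init c [n]).toStackMachine tr
  have hz : ∀ n, (z n).1 ∈ F := fun n => by
    refine Finset.mem_product.2 ⟨?_, Finset.mem_univ _⟩
    refine Finset.mem_insertNone.2 fun q hq => Finset.mem_biUnion.2
      ⟨_, (tr_supports c Cont'.halt).1, ?_⟩
    obtain rfl := Option.some.inj hq
    exact TM2.stmts₁_self
  refine ⟨Reg K', _, Bool, inferInstance, inferInstance, inferInstance, inferInstance,
    (TM2.toStackMachine tr).system code F, fun n => regs code (z n) 0, fun i => ?_, ?_⟩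
  · rcases i with (_ | _ | _ | _) | _ | _ | _
    · have h : ∀ n : ℕ, enc (trList [n]) = binaryCode (digit (some Γ'.bit0))
          (digit (some Γ'.bit1)) (enc [Γ'.cons]) (base Γ') n := by
        intro n
        rw [trList, trList, trNat, enc_trNum, Num.to_of_nat]
      exact (computable_binaryCode _ _ _ _).of_eq fun n => (h n).symm
    · exact Computable.const (enc ([] : List Γ'))
    · exact Computable.const (enc ([] : List Γ'))
    · exact Computable.const (enc ([] : List Γ'))
    · exact Computable.const 1
    · exact Computable.const (code (some (tr (trNormal c Cont'.halt)), none))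
    · exact Computable.const 0
  · intro h
    refine hc (h.of_eq fun n => ?_)
    rw [(TM2.toStackMachine tr).accepts_iff_dom code F hcode hF (z n) (hz n)]
    exact StateTransition.tr_eval_dom (TM2.respects_toStackMachine tr) rfl

end Universal

/-! ### The reduction -/

namespace ProbAutomaton

variable {Q S Q' S' : Type} [Fintype Q] [Fintype Q'] (A : ProbAutomaton Q S)
  (e : Q ≃ Q') (e' : S ≃ S')

/-- The automaton with states and letters renamed. -/
def reindex : ProbAutomaton Q' S' where
  init := e A.init
  M s q q' := A.M (e'.symm s) (e.symm q) (e.symm q')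
  nonneg _ _ _ := A.nonneg _ _ _
  sum_eq_one s q := by
    rw [e.symm.sum_comp fun q' => A.M (e'.symm s) (e.symm q) q', A.sum_eq_one]

theorem mass_reindex [DecidableEq Q] [DecidableEq Q'] (w : ℕ → S') (t : ℕ) (q : Q') :
    (A.reindex e e').mass w t q = A.mass (fun i => e'.symm (w i)) t (e.symm q) := by
  induction t generalizing q with
  | zero =>
    simp only [mass, reindex, Equiv.symm_apply_eq]
    by_cases h : q = e A.init <;> simp [h]
  | succ t ih =>
    simp only [mass, ih]
    exact e.symm.sum_comp fun q' => A.mass (fun i => e'.symm (w i)) t q' *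
      A.M (e'.symm (w t)) q' (e.symm q)

end ProbAutomaton

theorem computable_finset_sum {ι : Type} (s : Finset ι) (f : ι → ℕ → ℕ)
    (hf : ∀ i, Computable (f i)) : Computable fun n => ∑ i ∈ s, f i n := by
  classical
  induction s using Finset.induction_on with
  | empty => simpa using Computable.const 0
  | insert i s hi ih =>
    simp only [Finset.sum_insert hi]
    exact Primrec.nat_add.to_comp.comp (hf i) ih

namespace GuardedSystem

variable {d S G : Type} [Fintype d] [Fintype S] [Fintype G] (L : GuardedSystem d S G)

theorem computable_entry (x : ℕ → d → ℕ) (hx : ∀ i, Computable fun n => x n i) (s : S)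
    (q q' : State d) : Computable fun n => L.entry (x n) s q q' := by
  have hmul : ∀ p : d × d, Computable fun n => x n p.1 * x n p.2 := fun p =>
    Primrec.nat_mul.to_comp.comp (hx p.1) (hx p.2)
  have hden : Computable fun n => 1 + ∑ p : d × d, x n p.1 * x n p.2 :=
    Primrec.nat_add.to_comp.comp (Computable.const 1) (computable_finset_sum _ _ hmul)
  rcases q with p | _ | _ | _ | _
  · rcases q' with p' | _ | _ | _ | _ <;> exact Computable.const _
  · rcases q' with p' | _ | _ | _ | _
    · exact (hmul p').pair hden
    · exact Computable.const _
    · exact (Computable.const 1).pair hden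
    · exact Computable.const _
    · exact Computable.const _
  all_goals rcases q' with p' | _ | _ | _ | _ <;> exact Computable.const _

variable (x : d → ℕ)

/-- The automaton of a guarded system, on standard sets of states and letters. -/
noncomputable def finAutomaton :
    ProbAutomaton (Fin (Fintype.card (State d))) (Fin (Fintype.card S)) :=
  (L.automaton x).reindex (Fintype.equivFin _) (Fintype.equivFin _)

variable (d) in
/-- The accepting state of `finAutomaton`. -/
noncomputable def finAcc : Fin (Fintype.card (State d)) := Fintype.equivFin (State d) (.inr .acc)

theorem isAbsorbing_finAcc : (L.finAutomaton x).IsAbsorbing (finAcc d) := fun s => by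
  simpa [finAutomaton, finAcc, ProbAutomaton.reindex] using L.isAbsorbing_acc x _

/-- A description of `finAutomaton` with accepting states `F`. -/
noncomputable def automatonCode (F : Finset (Fin (Fintype.card (State d)))) : AutomatonCode :=
  (Fintype.card (State d), Fintype.card S, ((L.finAutomaton x).init : ℕ),
    List.ofFn fun q => decide (q ∈ F),
    List.ofFn fun s => List.ofFn fun q => List.ofFn fun q' =>
      L.entry x ((Fintype.equivFin S).symm s) ((Fintype.equivFin (State d)).symm q)
        ((Fintype.equivFin (State d)).symm q'))

theorem encodes_automatonCode (F : Finset (Fin (Fintype.card (State d)))) :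
    Encodes (L.automatonCode x F) (L.finAutomaton x) F :=
  ⟨_, fun _ _ _ => ⟨L.entry_snd_ne_zero x _ _ _, rfl⟩, rfl⟩

theorem computable_automatonCode (x : ℕ → d → ℕ) (hx : ∀ i, Computable fun n => x n i)
    (F : Finset (Fin (Fintype.card (State d)))) :
    Computable fun n => L.automatonCode (x n) F := by
  refine (Computable.const _).pair ((Computable.const _).pair
    ((Computable.const (Fintype.equivFin (State d) (.inr .start) : ℕ)).pair
      ((Computable.const _).pair ?_)))
  exact Computable.list_ofFn fun s => Computable.list_ofFn fun q => Computable.list_ofFn fun q' =>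
    L.computable_entry x hx _ _ _

variable [DecidableEq d]

theorem accepts_iff_acceptProb : L.Accepts x ↔
    ∃ w, (L.finAutomaton x).acceptProb (Reach {finAcc d}) w = 2 / 3 := by
  rw [accepts_iff_tendsto]
  have h : ∀ w, Filter.Tendsto (fun t => (L.automaton x).mass
      (fun i => (Fintype.equivFin S).symm (w i)) t (.inr .acc)) Filter.atTop
      (nhds ((L.finAutomaton x).acceptProb (Reach {finAcc d}) w)) := fun w => by
    refine ((L.finAutomaton x).tendsto_mass (L.isAbsorbing_finAcc x) w).congr fun t => ?_
    rw [finAutomaton, ProbAutomaton.mass_reindex, finAcc, Equiv.symm_apply_apply]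
  constructor
  · rintro ⟨w, hw⟩
    refine ⟨fun i => Fintype.equivFin S (w i), tendsto_nhds_unique (h _) ?_⟩
    simpa using hw
  · rintro ⟨w, hw⟩
    exact ⟨_, hw ▸ h w⟩

theorem accepts_iff_acceptProb_safe : L.Accepts x ↔
    ∃ w, (L.finAutomaton x).acceptProb (Safe {finAcc d}ᶜ) w = 1 / 3 := by
  rw [accepts_iff_acceptProb]
  refine exists_congr fun w => ?_
  rw [ProbAutomaton.acceptProb_safe_compl]
  constructor <;> intro h <;> linarith

end GuardedSystem

/-- If the equality problem is decidable, then so is it along every computable family of automata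
with the same size and the same accepting states. -/
theorem computablePred_of_quantEqualityDecidable
    {C : ∀ n m : ℕ, ProbAutomaton (Fin n) (Fin m) → Finset (Fin n) → Prop}
    {Φ : ∀ n : ℕ, Finset (Fin n) → Set (ℕ → Fin n)} {Λ : Set ℚ}
    (h : QuantEqualityDecidable C Φ Λ) {n m : ℕ} (A : ℕ → ProbAutomaton (Fin n) (Fin m))
    (F : Finset (Fin n)) (r : ℚ) (c : ℕ → AutomatonCode) (l : ℕ × ℕ) (hC : ∀ k, C n m (A k) F)
    (hr : r ∈ Λ) (hc : Computable c) (hcode : ∀ k, Encodes (c k) (A k) F)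
    (hl : IsFraction l (r : ℝ)) :
    ComputablePred fun k => ∃ w, (A k).acceptProb (Φ n F) w = (r : ℝ) := by
  obtain ⟨f, hf, hspec⟩ := h
  choose b hb hbr using fun k => hspec n m (A k) F r (c k) l (hC k) hr (hcode k) hl
  refine ComputablePred.computable_iff.2 ⟨b, ?_, funext fun k => propext (hbr k).symm⟩
  exact (hf.comp (hc.pair (Computable.const l))).of_eq fun k => Part.eq_some_iff.2 (hb k)

theorem QuantEqualityDecidable.mono
    {C : ∀ n m : ℕ, ProbAutomaton (Fin n) (Fin m) → Finset (Fin n) → Prop}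
    {Φ : ∀ n : ℕ, Finset (Fin n) → Set (ℕ → Fin n)} {Λ Λ' : Set ℚ} (hΛ : Λ ⊆ Λ')
    (h : QuantEqualityDecidable C Φ Λ') : QuantEqualityDecidable C Φ Λ := by
  obtain ⟨f, hf, hspec⟩ := h
  exact ⟨f, hf, fun n m A F r c l hC hr => hspec n m A F r c l hC (hΛ hr)⟩

theorem not_quantEqualityDecidable_safe :
    ¬ QuantEqualityDecidable (fun _ _ _ _ => True) (fun _ F => Safe F) {1 / 3} := by
  obtain ⟨d, S, G, _, _, _, _, L, x, hx, hL⟩ := exists_guardedSystem_undecidable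
  intro h
  refine hL ((computablePred_of_quantEqualityDecidable h (fun k => L.finAutomaton (x k))
    {GuardedSystem.finAcc d}ᶜ (1 / 3) (fun k => L.automatonCode (x k) _) (1, 3)
    (fun _ => trivial) rfl (L.computable_automatonCode x hx _)
    (fun k => L.encodes_automatonCode (x k) _) ⟨by norm_num, by norm_num⟩).of_eq fun k => ?_)
  rw [L.accepts_iff_acceptProb_safe]
  norm_num

theorem not_quantEqualityDecidable_reach :
    ¬ QuantEqualityDecidable (fun _ _ A F => A.AcceptanceAbsorbing F) (fun _ F => Reach F)
      {2 / 3} := by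
  obtain ⟨d, S, G, _, _, _, _, L, x, hx, hL⟩ := exists_guardedSystem_undecidable
  intro h
  refine hL ((computablePred_of_quantEqualityDecidable h (fun k => L.finAutomaton (x k))
    {GuardedSystem.finAcc d} (2 / 3) (fun k => L.automatonCode (x k) _) (2, 3)
    (fun k q hq => ?_) rfl (L.computable_automatonCode x hx _)
    (fun k => L.encodes_automatonCode (x k) _) ⟨by norm_num, by norm_num⟩).of_eq fun k => ?_)
  · rw [Finset.mem_singleton.1 hq]
    exact L.isAbsorbing_finAcc (x k)
  · rw [L.accepts_iff_acceptProb]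
    norm_num

theorem theorem1 :
    -- safety automata, threshold `0 < r < 1` part of the input
    ¬ QuantEqualityDecidable (fun _ _ _ _ => True) (fun _ F => Safe F) (Set.Ioo 0 1) ∧
    -- acceptance-absorbing reachability automata, threshold `0 < r < 1` part of the input
    ¬ QuantEqualityDecidable (fun _ _ A F => A.AcceptanceAbsorbing F) (fun _ F => Reach F)
      (Set.Ioo 0 1) ∧
    -- the same with the fixed thresholds `1 / 3` and `2 / 3`
    ¬ QuantEqualityDecidable (fun _ _ _ _ => True) (fun _ F => Safe F) {1 / 3} ∧
    ¬ QuantEqualityDecidable (fun _ _ A F => A.AcceptanceAbsorbing F) (fun _ F => Reach F)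
      {2 / 3} := by
  refine ⟨fun h => not_quantEqualityDecidable_safe (h.mono ?_),
    fun h => not_quantEqualityDecidable_reach (h.mono ?_),
    not_quantEqualityDecidable_safe, not_quantEqualityDecidable_reach⟩
  · rintro _ rfl
    constructor <;> norm_num
  · rintro _ rfl
    constructor <;> norm_num
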